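/- Let $L$ be a Lie algebra (of arbitrary, possibly infinite, dimension) over an arbitrary field $\mathbb{F}$, and let $U(L)$ be its (ordinary) universal enveloping algebra. A ring $R$ with unity and Jacobson radical $\mathcal{J}(R)$ is called semiperfect if $R/\mathcal{J}(R)$ is Artinian and every idempotent of $R/\mathcal{J}(R)$ lifts to an idempotent of $R$. Then $U(L)$ is semiperfect if and only if $L=0$. -/

import Mathlib

/-- A unital ring `R` with Jacobson radical `J` is semiperfect if `R ⧸ J` is Artinian and every
idempotent of `R ⧸ J` lifts to an idempotent of `R`. (Since `R ⧸ J` has zero Jacobson radical, it is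
left Artinian if and only if it is right Artinian, so no side has to be specified; `IsArtinianRing`
is the left-sided condition.) -/
structure IsSemiperfectRing (R : Type*) [Ring R] : Prop where
  isArtinianRing_quotient : IsArtinianRing (R ⧸ Ring.jacobson R)
  exists_isIdempotentElem_lift : ∀ e : R ⧸ Ring.jacobson R, IsIdempotentElem e →
    ∃ f : R, IsIdempotentElem f ∧ Ideal.Quotient.mk (Ring.jacobson R) f = e

/-! If `R / J(R)` is Artinian, then for every `a` in `R` some nonconstant polynomial in `a` is a
unit: this holds modulo `J(R)` by the descending chain condition, and units lift. For nonzero `L` it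
fails in `U(L)`, as a representation shows; PBW is not needed. If `L` is abelian, a functional with
value 1 at `x` gives a map to `F[X]` sending `x` to `X`. Otherwise choose `⁅x, v⁆ ≠ 0` and let `x`
act on the symmetric algebra of `L` by `ad x` plus multiplication by `⁅x, v⁆`, formally the
conjugate of `ad x` by `exp v`. This raises degree by exactly one, so no nonconstant polynomial in
it has 1 in its image. Conversely, `U(0)` is a quotient of `F`. -/

open Polynomial in
/-- For every element `a` of an Artinian algebra over a field, some nonconstant polynomial in `a` is
a unit. -/
theorem exists_isUnit_aeval_of_isArtinianRing (F : Type*) [Field F] {A : Type*} [Ring A]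
    [Algebra F A] [IsArtinianRing A] (a : A) :
    ∃ p : F[X], 0 < p.natDegree ∧ IsUnit (aeval a p) := by
  obtain ⟨I, ⟨q, hq, rfl⟩, hmin⟩ := WellFounded.has_min (wellFounded_lt (α := Submodule A A))
    {I | ∃ q : F[X], q ≠ 0 ∧ I = Submodule.span A {aeval a q}} ⟨_, 1, one_ne_zero, rfl⟩
  have hdeg : (1 + X * q).natDegree = q.natDegree + 1 := by
    rw [add_comm, ← C_1, natDegree_add_C, natDegree_X_mul hq]
  have hp0 : (1 + X * q) ≠ 0 := by
    intro h
    rw [h] at hdeg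
    simp at hdeg
  -- Here `A q(a)` is minimal, so multiplying `q` by this polynomial leaves the left ideal
  -- unchanged; being 1 modulo `q`, it also fixes every left annihilator of `q(a)`.
  refine ⟨1 + X * q, by lia, ?_⟩
  set P := aeval a (1 + X * q) with hP
  set Q := aeval a q with hQ
  have hPQ : P = 1 + Q * a := by
    rw [hP, mul_comm X q]; simp [hQ]
  have hle : Submodule.span A {P * Q} ≤ Submodule.span A {Q} := by
    rw [Submodule.span_singleton_le_iff_mem, Submodule.mem_span_singleton]
    exact ⟨P, rfl⟩
  have hmem : Q ∈ Submodule.span A {P * Q} := by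
    have := hmin (Submodule.span A {P * Q}) ⟨(1 + X * q) * q, mul_ne_zero hp0 hq, by
      rw [map_mul]⟩
    rw [eq_of_le_of_not_lt hle this]
    exact Submodule.mem_span_singleton_self _
  obtain ⟨b, hb⟩ := Submodule.mem_span_singleton.1 hmem
  rw [smul_eq_mul] at hb
  -- `1 - b * P` kills `Q`, so right multiplication by `P = 1 + Q * a` fixes it; adding it to `b`
  -- corrects `b * P` to 1.
  set c := b + (1 - b * P)
  have hc : c * P = 1 := by
    have h0 : (1 - b * P) * Q = 0 := by rw [sub_mul, mul_assoc, hb, one_mul, sub_self]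
    have h1 : (1 - b * P) * P = 1 - b * P := by
      conv_lhs => rw [hPQ, mul_add, ← hPQ, ← mul_assoc, h0]
      simp
    rw [add_mul, h1]; abel
  -- Right multiplication by `c` is injective, hence surjective on the Artinian module `A`, which
  -- makes the left inverse two-sided.
  have hinj : Function.Injective (LinearMap.toSpanSingleton A A c) := by
    intro u v huv
    simp only [LinearMap.toSpanSingleton_apply, smul_eq_mul] at huv
    rw [← mul_one u, ← mul_one v, ← hc, ← mul_assoc, huv, mul_assoc]
  obtain ⟨d, hd⟩ := IsArtinian.surjective_of_injective_endomorphism _ hinj 1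
  simp only [LinearMap.toSpanSingleton_apply, smul_eq_mul] at hd
  have hdP : d = P := by
    rw [← mul_one d, ← hc, ← mul_assoc, hd, one_mul]
  exact ⟨⟨P, c, hdP ▸ hd, hc⟩, rfl⟩

/-- An element that is invertible modulo the Jacobson radical is invertible. -/
theorem isUnit_of_isUnit_mk_jacobson {R : Type*} [Ring R] {r : R}
    (h : IsUnit (Ideal.Quotient.mk (Ring.jacobson R) r)) : IsUnit r := by
  obtain ⟨s, hs⟩ := Ideal.Quotient.mk_surjective (I := Ring.jacobson R) ((h.unit⁻¹ : _) : _)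
  have left_inv : ∀ t : R, Ideal.Quotient.mk (Ring.jacobson R) t = 1 → ∃ z, z * t = 1 := by
    intro t ht
    obtain ⟨z, hz⟩ := Ideal.exists_mul_sub_mem_of_sub_one_mem_jacobson (I := (⊥ : Ideal R)) t (by
      rw [Ideal.jacobson_bot, ← Ideal.Quotient.eq_zero_iff_mem, map_sub, ht, map_one, sub_self])
    exact ⟨z, sub_eq_zero.1 hz⟩
  have right_inv : ∀ t : R, Ideal.Quotient.mk (Ring.jacobson R) t = 1 → ∃ z, t * z = 1 := by
    intro t ht
    obtain ⟨z, hz⟩ := left_inv t ht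
    -- The left inverse `z` is again 1 modulo the radical, so it has its own left inverse, which
    -- must equal `t`.
    obtain ⟨y, hy⟩ := left_inv z (by
      have := congrArg (Ideal.Quotient.mk (Ring.jacobson R)) hz
      rwa [map_mul, ht, mul_one, map_one] at this)
    exact ⟨z, left_inv_eq_right_inv hy hz ▸ hy⟩
  obtain ⟨z, hz⟩ := left_inv (s * r) (by rw [map_mul, hs]; exact h.val_inv_mul)
  obtain ⟨w, hw⟩ := right_inv (r * s) (by rw [map_mul, hs]; exact h.mul_val_inv)
  rw [← mul_assoc] at hz
  rw [mul_assoc] at hw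
  exact ⟨⟨r, s * w, hw, left_inv_eq_right_inv hz hw ▸ hz⟩, rfl⟩

open Polynomial in
/-- If `R` modulo its Jacobson radical is Artinian, then every element of `R` has a nonconstant
polynomial expression which is a unit. -/
theorem exists_isUnit_aeval_of_isArtinianRing_quotient_jacobson (F : Type*) [Field F] {R : Type*}
    [Ring R] [Algebra F R] (h : IsArtinianRing (R ⧸ Ring.jacobson R)) (a : R) :
    ∃ p : F[X], 0 < p.natDegree ∧ IsUnit (aeval a p) := by
  obtain ⟨p, hp, hu⟩ := exists_isUnit_aeval_of_isArtinianRing F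
    (Ideal.Quotient.mkₐ F (Ring.jacobson R) a)
  refine ⟨p, hp, isUnit_of_isUnit_mk_jacobson ?_⟩
  rwa [aeval_algHom_apply] at hu

open Polynomial in
/-- An endomorphism `T` of a polynomial ring raising total degrees by one makes every nonconstant
polynomial in `T` non-invertible. -/
theorem not_isUnit_aeval_of_totalDegree_succ {F : Type*} [Field F] {σ : Type*}
    (T : Module.End F (MvPolynomial σ F))
    (hT : ∀ g, g ≠ 0 → (T g).totalDegree = g.totalDegree + 1) (p : F[X]) (hp : 0 < p.natDegree) :
    ¬ IsUnit (aeval T p) := by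
  have hpow : ∀ (n : ℕ) (g : MvPolynomial σ F), g ≠ 0 →
      ((T ^ n) g).totalDegree = g.totalDegree + n := by
    intro n
    induction n with
    | zero => simp
    | succ n ih =>
      intro g hg
      have hne : T g ≠ 0 := by
        intro h0
        have := hT g hg
        rw [h0] at this
        simp at this
      rw [pow_succ, Module.End.mul_apply, ih _ hne, hT g hg]
      ring
  intro hu
  obtain ⟨g, hg⟩ := ((Module.End.isUnit_iff _).1 hu).2 1
  have hg0 : g ≠ 0 := by
    rintro rfl
    simp at hg
  have hlead : p.leadingCoeff ≠ 0 := by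
    rw [Ne, leadingCoeff_eq_zero]
    rintro rfl
    simp at hp
  have hdeg : (aeval T p g).totalDegree = g.totalDegree + p.natDegree := by
    rw [aeval_eq_sum_range, Finset.sum_range_succ, LinearMap.add_apply, LinearMap.smul_apply,
      coeff_natDegree, LinearMap.sum_apply]
    have hdl : (p.leadingCoeff • (T ^ p.natDegree) g).totalDegree =
        g.totalDegree + p.natDegree := by
      rw [← hpow _ _ hg0]
      refine le_antisymm (MvPolynomial.totalDegree_smul_le _ _) ?_
      conv_lhs => rw [← inv_smul_smul₀ hlead ((T ^ p.natDegree) g)]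
      exact MvPolynomial.totalDegree_smul_le _ _
    rw [MvPolynomial.totalDegree_add_eq_right_of_totalDegree_lt, hdl]
    rw [hdl]
    -- The truncated `- 1` is a true predecessor because `p` is nonconstant.
    refine lt_of_le_of_lt (MvPolynomial.totalDegree_finsetSum_le
      (d := g.totalDegree + p.natDegree - 1) ?_) (by lia)
    intro i hi
    rw [Finset.mem_range] at hi
    refine (MvPolynomial.totalDegree_smul_le _ _).trans ?_
    rw [hpow _ _ hg0]
    lia
  rw [hg, MvPolynomial.totalDegree_one] at hdeg
  lia

/-- A derivation sending the variables to linear forms does not raise the total degree. -/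
theorem MvPolynomial.totalDegree_mkDerivation_le {F : Type*} [Field F] {σ : Type*}
    (f : σ → MvPolynomial σ F) (hf : ∀ i, (f i).totalDegree ≤ 1) (g : MvPolynomial σ F) :
    (MvPolynomial.mkDerivation F f g).totalDegree ≤ g.totalDegree := by
  conv_lhs => rw [g.as_sum, map_sum]
  refine MvPolynomial.totalDegree_finsetSum_le fun s hs => ?_
  rw [MvPolynomial.mkDerivation_monomial]
  refine (MvPolynomial.totalDegree_smul_le _ _).trans ?_
  refine MvPolynomial.totalDegree_finsetSum_le fun i hi => ?_
  refine le_trans ?_ (MvPolynomial.le_totalDegree hs)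
  refine (MvPolynomial.totalDegree_mul _ _).trans ?_
  refine (add_le_add (MvPolynomial.totalDegree_monomial_le _ _) (hf i)).trans ?_
  -- Differentiating by a variable that occurs lowers the degree by one; the linear factor `f i`
  -- restores at most one.
  have hle : Finsupp.single i 1 ≤ s := by
    rw [Finsupp.single_le_iff]
    exact Nat.one_le_iff_ne_zero.2 (Finsupp.mem_support_iff.1 hi)
  conv_rhs => rw [← tsub_add_cancel_of_le hle]
  rw [Finsupp.sum_add_index' (by simp) (by simp)]
  simp only [Finsupp.sum_single_index]
  exact le_rfl

section PolynomialRepresentation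

attribute [local instance 100] LieRing.ofAssociativeRing

variable {F L σ : Type*} [Field F] [LieRing L] [LieAlgebra F L] (b : Module.Basis σ F L)

/-- Elements of `L` as linear forms in the polynomial ring on a basis of `L`. -/
noncomputable def linearForm : L →ₗ[F] MvPolynomial σ F :=
  b.constr F MvPolynomial.X

theorem linearForm_basis (i : σ) : linearForm b (b i) = MvPolynomial.X i := by
  simp [linearForm]

theorem linearForm_isHomogeneous (x : L) : (linearForm b x).IsHomogeneous 1 := by
  rw [linearForm, Module.Basis.constr_apply]
  exact MvPolynomial.IsHomogeneous.sum _ _ _ fun i _ => by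
    beta_reduce
    rw [MvPolynomial.smul_eq_C_mul]
    simpa using (MvPolynomial.isHomogeneous_C σ _).mul (MvPolynomial.isHomogeneous_X F i)

theorem linearForm_injective : Function.Injective (linearForm b) :=
  b.injective_constr_of_linearIndependent (MvPolynomial.linearIndependent_X σ F)

/-- The derivation of the polynomial ring on a basis of `L` extending `ad x`. -/
noncomputable def adDerivation (x : L) : Derivation F (MvPolynomial σ F) (MvPolynomial σ F) :=
  MvPolynomial.mkDerivation F fun i => linearForm b ⁅x, b i⁆

theorem adDerivation_linearForm (x y : L) :
    adDerivation b x (linearForm b y) = linearForm b ⁅x, y⁆ := by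
  have : (adDerivation b x).toLinearMap ∘ₗ linearForm b =
      linearForm b ∘ₗ (LieAlgebra.ad F L x : L →ₗ[F] L) := by
    refine b.ext fun i => ?_
    simp [linearForm_basis, adDerivation]
  exact LinearMap.congr_fun this y

theorem adDerivation_add (x y : L) :
    adDerivation b (x + y) = adDerivation b x + adDerivation b y := by
  refine MvPolynomial.derivation_ext fun i => ?_
  simp [← linearForm_basis b, adDerivation_linearForm]

theorem adDerivation_smul (c : F) (x : L) :
    adDerivation b (c • x) = c • adDerivation b x := by
  refine MvPolynomial.derivation_ext fun i => ?_
  simp [← linearForm_basis b, adDerivation_linearForm]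

theorem adDerivation_lie (x y : L) :
    adDerivation b ⁅x, y⁆ = ⁅adDerivation b x, adDerivation b y⁆ := by
  refine MvPolynomial.derivation_ext fun i => ?_
  simp [← linearForm_basis b, adDerivation_linearForm, Derivation.commutator_apply]

/-- The representation of `L` on the polynomial ring on a basis of `L`, in which `x` acts as the
derivation extending `ad x` plus multiplication by the linear form `⁅x, v⁆`. -/
noncomputable def twistedAdjoint (v : L) : L →ₗ⁅F⁆ Module.End F (MvPolynomial σ F) where
  toFun x := (adDerivation b x).toLinearMap + LinearMap.mulLeft F (linearForm b ⁅x, v⁆)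
  map_add' x y := by
    refine LinearMap.ext fun g => ?_
    change adDerivation b (x + y) g + linearForm b ⁅x + y, v⁆ * g =
      (adDerivation b x g + linearForm b ⁅x, v⁆ * g) +
        (adDerivation b y g + linearForm b ⁅y, v⁆ * g)
    rw [adDerivation_add, Derivation.add_apply, add_lie, map_add]
    ring
  map_smul' c x := by
    refine LinearMap.ext fun g => ?_
    change adDerivation b (c • x) g + linearForm b ⁅c • x, v⁆ * g =
      c • (adDerivation b x g + linearForm b ⁅x, v⁆ * g)
    rw [adDerivation_smul, Derivation.smul_apply, smul_lie, map_smul, smul_add, smul_mul_assoc]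
  map_lie' := by
    intro x y
    refine LinearMap.ext fun g => ?_
    change adDerivation b ⁅x, y⁆ g + linearForm b ⁅⁅x, y⁆, v⁆ * g =
      (adDerivation b x (adDerivation b y g + linearForm b ⁅y, v⁆ * g) +
        linearForm b ⁅x, v⁆ * (adDerivation b y g + linearForm b ⁅y, v⁆ * g)) -
      (adDerivation b y (adDerivation b x g + linearForm b ⁅x, v⁆ * g) +
        linearForm b ⁅y, v⁆ * (adDerivation b x g + linearForm b ⁅x, v⁆ * g))
    -- By the Jacobi identity `x ↦ ⁅x, v⁆` is a 1-cocycle; the products of two linear forms cancel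
    -- by commutativity.
    rw [adDerivation_lie, Derivation.commutator_apply, lie_lie, map_sub, map_add, map_add,
      Derivation.leibniz, Derivation.leibniz, adDerivation_linearForm, adDerivation_linearForm]
    simp only [smul_eq_mul]
    ring

theorem totalDegree_twistedAdjoint {x v : L} (h : ⁅x, v⁆ ≠ 0) (g : MvPolynomial σ F) (hg : g ≠ 0) :
    (twistedAdjoint b v x g).totalDegree = g.totalDegree + 1 := by
  have hw : linearForm b ⁅x, v⁆ ≠ 0 := (map_ne_zero_iff _ (linearForm_injective b)).2 h
  have h1 : (linearForm b ⁅x, v⁆ * g).totalDegree = g.totalDegree + 1 := by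
    rw [MvPolynomial.totalDegree_mul_of_isDomain hw hg,
      (linearForm_isHomogeneous b _).totalDegree hw, add_comm]
  have h2 : (adDerivation b x g).totalDegree ≤ g.totalDegree :=
    MvPolynomial.totalDegree_mkDerivation_le _
      (fun i => (linearForm_isHomogeneous b _).totalDegree_le) g
  change (adDerivation b x g + linearForm b ⁅x, v⁆ * g).totalDegree = _
  rw [MvPolynomial.totalDegree_add_eq_right_of_totalDegree_lt (by lia), h1]

end PolynomialRepresentation

namespace UniversalEnvelopingAlgebra

attribute [local instance 100] LieRing.ofAssociativeRing

variable (F : Type*) [Field F] {L : Type*} [LieRing L] [LieAlgebra F L]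

open Polynomial in
/-- If `L` is nonzero, its enveloping algebra has an element no nonconstant polynomial in which is
invertible. -/
theorem exists_forall_not_isUnit_aeval [Nontrivial L] :
    ∃ a : UniversalEnvelopingAlgebra F L, ∀ p : F[X], 0 < p.natDegree → ¬ IsUnit (aeval a p) := by
  by_cases hab : ∀ x y : L, ⁅x, y⁆ = 0
  · obtain ⟨x, hx⟩ := exists_ne (0 : L)
    obtain ⟨f, hf⟩ := Module.Projective.exists_dual_eq_one F hx
    let φ : L →ₗ⁅F⁆ F[X] :=
      { (LinearMap.toSpanSingleton F F[X] X) ∘ₗ f with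
        map_lie' := by
          intro y z
          simp [hab, LieRing.of_associative_ring_bracket, mul_comm] }
    refine ⟨ι F x, fun p hp hu => ?_⟩
    have := hu.map (lift F φ)
    rw [← aeval_algHom_apply, lift_ι_apply] at this
    have hφ : φ x = X := by
      change f x • (X : F[X]) = X
      rw [hf, one_smul]
    rw [hφ, aeval_X_left_apply] at this
    exact hp.ne' (natDegree_eq_zero_of_isUnit this)
  · push Not at hab
    obtain ⟨x, v, h⟩ := hab
    let b := Module.Basis.ofVectorSpace F L
    refine ⟨ι F x, fun p hp hu => ?_⟩
    have := hu.map (lift F (twistedAdjoint b v))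
    rw [← aeval_algHom_apply, lift_ι_apply] at this
    exact not_isUnit_aeval_of_totalDegree_succ _ (totalDegree_twistedAdjoint b h) p hp this

theorem algebraMap_surjective_of_subsingleton [Subsingleton L] :
    Function.Surjective (algebraMap F (UniversalEnvelopingAlgebra F L)) := by
  have h : (Algebra.ofId F (UniversalEnvelopingAlgebra F L)).comp (lift F (0 : L →ₗ⁅F⁆ F)) =
      AlgHom.id F _ := by
    ext x
    simp [Subsingleton.elim x 0]
  exact fun u => ⟨lift F (0 : L →ₗ⁅F⁆ F) u, AlgHom.congr_fun h u⟩

end UniversalEnvelopingAlgebra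

/-- A ring which is a quotient of a field is semiperfect. -/
theorem IsSemiperfectRing.of_surjective {F R : Type*} [Field F] [Ring R] (f : F →+* R)
    (hf : Function.Surjective f) : IsSemiperfectRing R := by
  have hsurj := (Ideal.Quotient.mk_surjective (I := Ring.jacobson R)).comp hf
  refine ⟨Function.Surjective.isArtinianRing (f := (Ideal.Quotient.mk (Ring.jacobson R)).comp f)
    hsurj, fun e he => ?_⟩
  obtain ⟨c, rfl⟩ := hsurj e
  rcases eq_or_ne c 0 with rfl | hc
  · exact ⟨0, IsIdempotentElem.zero, by simp⟩
  · refine ⟨1, IsIdempotentElem.one, ?_⟩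
    -- The image of a nonzero scalar is a unit, and the only idempotent unit is 1.
    have hu : IsUnit (((Ideal.Quotient.mk (Ring.jacobson R)).comp f) c) := hc.isUnit.map _
    rw [map_one]
    exact ((IsIdempotentElem.iff_eq_one_of_isUnit hu).1 he).symm

theorem corollary2p3 (F : Type*) [Field F] (L : Type*) [LieRing L] [LieAlgebra F L] :
    IsSemiperfectRing (UniversalEnvelopingAlgebra F L) ↔ Subsingleton L := by
  refine ⟨fun h => ?_, fun _ => .of_surjective _
    (UniversalEnvelopingAlgebra.algebraMap_surjective_of_subsingleton F)⟩
  by_contra hL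
  rw [not_subsingleton_iff_nontrivial] at hL
  obtain ⟨a, ha⟩ := UniversalEnvelopingAlgebra.exists_forall_not_isUnit_aeval F (L := L)
  obtain ⟨p, hp, hu⟩ :=
    exists_isUnit_aeval_of_isArtinianRing_quotient_jacobson F h.isArtinianRing_quotient a
  exact ha p hp hu
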